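/- Let $I,J\ge 2$ and consider the two-factor design $[I]\times[J]$ with the simple effect model $\mu_{i,j}=\mu+\alpha_i+\beta_j$. Its model matrix $X=(m_0\,|\,a_1\,|\cdots|\,a_{I-1}\,|\,b_1\,|\cdots|\,b_{J-1})$ has rows indexed by $[I]\times[J]$; $m_0$ is the column of $1$'s, $a_i$ is the indicator vector of the level $i$ of the first factor, and $b_j$ is the indicator vector of the level $j$ of the second factor. A subset $\mathcal F\subseteq[I]\times[J]$ is called a saturated fraction if $\#\mathcal F=I+J-1$ and the square submatrix $X_{\mathcal F}$ of $X$ formed by the rows indexed by $\mathcal F$ is non-singular. The margins of $\mathcal F$ are the vectors $m_A(\mathcal F)$ and $m_B(\mathcal F)$ with entries $m_{A,i}(\mathcal F)=\#\{(d_1,d_2)\in\mathcal F: d_1=i\}$ for $i\in[I]$ and $m_{B,j}(\mathcal F)=\#\{(d_1,d_2)\in\mathcal F: d_2=j\}$ for $j\in[J]$. Let $m_A=(m_{A,1},\dots,m_{A,I})$ and $m_B=(m_{B,1},\dots,m_{B,J})$ be vectors of integers with $m_{A,i}\ge1$ for all $i$, $m_{B,j}\ge 1$ for all $j$, and $\sum_i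 m_{A,i}=\sum_j m_{B,j}=I+J-1$. Then the number of saturated fractions $\mathcal F\subseteq[I]\times[J]$ with $m_A(\mathcal F)=m_A$ and $m_B(\mathcal F)=m_B$ is $$\binom{I-1}{m_{B,1}-1,\dots,m_{B,J}-1}\binom{J-1}{m_{A,1}-1,\dots,m_{A,I}-1}.$$ -/

import Mathlib

namespace TwoFactor

/-- A fraction of the full factorial design `[I] × [J]`: a set of design points. -/
abbrev Fraction (I J : ℕ) := Finset (Fin I × Fin J)

/-- The indices of the columns of the model matrix: one for the mean, one for each of the first
`I - 1` levels of the factor `A`, and one for each of the first `J - 1` levels of the factor `B`. -/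
abbrev Param (I J : ℕ) := Unit ⊕ (Fin (I - 1) ⊕ Fin (J - 1))

/-- The model matrix `(m₀ | a₁ | … | a_{I-1} | b₁ | … | b_{J-1})` of the simple effect model
on the full design: `m₀` is constant `1`, and the `a`'s and `b`'s are indicators of levels. -/
def modelMatrix (I J : ℕ) : Matrix (Fin I × Fin J) (Param I J) ℝ
  | _, .inl _ => 1
  | d, .inr (.inl i) => if (d.1 : ℕ) = (i : ℕ) then 1 else 0
  | d, .inr (.inr j) => if (d.2 : ℕ) = (j : ℕ) then 1 else 0

/-- The rows of the model matrix that belong to the points of the fraction `F`. -/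
def fractionMatrix {I J : ℕ} (F : Fraction I J) : Matrix {d // d ∈ F} (Param I J) ℝ :=
  (modelMatrix I J).submatrix Subtype.val id

/-- A fraction is saturated if it has `I + J - 1` points and its model matrix is non-singular.
The determinant of this square matrix needs an ordering `e` of its rows; another ordering changes
only the sign, so that it does not matter which one is taken. -/
def IsSaturated {I J : ℕ} (F : Fraction I J) : Prop :=
  F.card = I + J - 1 ∧
    ∃ e : Param I J ≃ {d // d ∈ F}, ((fractionMatrix F).submatrix e id).det ≠ 0

/-- The `A`-margin of a fraction. -/
def marginA {I J : ℕ} (F : Fraction I J) (i : Fin I) : ℕ :=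
  ∑ d ∈ F, if d.1 = i then 1 else 0

/-- The `B`-margin of a fraction. -/
def marginB {I J : ℕ} (F : Fraction I J) (j : Fin J) : ℕ :=
  ∑ d ∈ F, if d.2 = j then 1 else 0

end TwoFactor

/-! Read `F` as the edge set of a bipartite graph on the levels of the two factors. A kernel vector
of the fraction's matrix amounts to potentials `u`, `v` that agree along the edges, up to a common
constant, so non-singularity means that the graph is connected (`isSaturated_iff_linked`). With `I +
J - 1` edges it is then a spanning tree of the complete bipartite graph, and the margins are its
degrees.

Trees with given degrees are counted by removing leaves (`card_linkedSets`). The larger side has a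
vertex of degree 1. Deleting it lowers the degree of its neighbour `j` by one, and summing over `j`
is Pascal's rule for the multinomial of the `b j - 1` (`multinomial_eq_sum_update_pred`); the other
multinomial only loses a part equal to 0. -/

open Finset

namespace TwoFactor

/-! ### Multinomial coefficients -/

section Multinomial

variable {β : Type*} [DecidableEq β]

theorem prod_factorial_update_pred (B : Finset β) (c : β → ℕ) {j : β} (hj : j ∈ B)
    (hc : c j ≠ 0) :
    ∏ k ∈ B, (c k).factorial =
      c j * ∏ k ∈ B, (Function.update c j (c j - 1) k).factorial := by
  rw [← Finset.mul_prod_erase B _ hj, ← Finset.mul_prod_erase B _ hj,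
    ← Nat.mul_factorial_pred hc, Function.update_self, mul_assoc]
  congr 2
  refine Finset.prod_congr rfl fun k hk => ?_
  rw [Function.update_of_ne (Finset.ne_of_mem_erase hk)]

theorem sum_update_pred (B : Finset β) (c : β → ℕ) {j : β} (hj : j ∈ B) (hc : c j ≠ 0) :
    ∑ k ∈ B, Function.update c j (c j - 1) k + 1 = ∑ k ∈ B, c k := by
  rw [← Finset.add_sum_erase B _ hj, ← Finset.add_sum_erase B c hj, Function.update_self,
    Finset.sum_congr rfl fun k hk => Function.update_of_ne (Finset.ne_of_mem_erase hk) _ _]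
  lia

/-- Pascal's rule for multinomial coefficients. -/
theorem multinomial_eq_sum_update_pred (B : Finset β) (c : β → ℕ) (hc : ∑ j ∈ B, c j ≠ 0) :
    Nat.multinomial B c =
      ∑ j ∈ B, if c j = 0 then 0 else Nat.multinomial B (Function.update c j (c j - 1)) := by
  have hpos : 0 < ∏ k ∈ B, (c k).factorial := Finset.prod_pos fun k _ => Nat.factorial_pos _
  refine Nat.eq_of_mul_eq_mul_left hpos ?_
  rw [Nat.multinomial_spec, Finset.mul_sum, ← Nat.mul_factorial_pred hc, Finset.sum_mul]
  refine Finset.sum_congr rfl fun j hj => ?_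
  split_ifs with h
  · simp [h]
  · rw [prod_factorial_update_pred B c hj h, mul_assoc, Nat.multinomial_spec,
      ← sum_update_pred B c hj h, Nat.add_sub_cancel]

theorem multinomial_erase_of_eq_zero (B : Finset β) (c : β → ℕ) {j : β} (hj : j ∈ B)
    (hc : c j = 0) : Nat.multinomial (B.erase j) c = Nat.multinomial B c := by
  conv_rhs => rw [← Finset.insert_erase hj, Nat.multinomial_insert (Finset.notMem_erase j B)]
  simp [hc]

end Multinomial

/-! ### Degree sums and leaves -/

section Margins

variable {α : Type*}

theorem sum_tsub_one_add_card {A : Finset α} {a : α → ℕ} (ha : ∀ i ∈ A, 1 ≤ a i) :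
    ∑ i ∈ A, (a i - 1) + #A = ∑ i ∈ A, a i := by
  rw [Finset.card_eq_sum_ones, ← Finset.sum_add_distrib]
  exact Finset.sum_congr rfl fun i hi => Nat.sub_add_cancel (ha i hi)

/-- Source of leaves: a tree's degrees on side `A` sum to `#A + #B - 1`, which is below `2 * #A` if
`#B ≤ #A`. -/
theorem exists_eq_one_of_sum_lt {A : Finset α} {a : α → ℕ} (ha : ∀ i ∈ A, 1 ≤ a i)
    (h : ∑ i ∈ A, a i < 2 * #A) : ∃ i ∈ A, a i = 1 := by
  by_contra! hne
  have : #A • 2 ≤ ∑ i ∈ A, a i := Finset.card_nsmul_le_sum _ _ _ fun i hi => by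
    have := ha i hi
    have := hne i hi
    lia
  rw [smul_eq_mul] at this
  lia

end Margins

/-! ### Connected bipartite graphs with given degrees -/

section Linked

variable {α β : Type*}

/-- A set `F` of edges links the vertex sets `A` and `B` if two potentials on the two sides that
agree along every edge of `F` agree everywhere. -/
def Linked (A : Finset α) (B : Finset β) (F : Finset (α × β)) : Prop :=
  ∀ (u : α → ℝ) (v : β → ℝ), (∀ d ∈ F, u d.1 = v d.2) → ∀ i ∈ A, ∀ j ∈ B, u i = v j

theorem Linked.exists_mem_snd {A : Finset α} {B : Finset β} {F : Finset (α × β)}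
    (h : Linked A B F) {i : α} (hi : i ∈ A) {j : β} (hj : j ∈ B) : ∃ d ∈ F, d.2 = j := by
  classical
  by_contra! hF
  -- The indicator of an isolated vertex `j` agrees with 0 along all edges.
  have := h (fun _ => 0) (fun k => if k = j then 1 else 0)
    (fun d hd => by simp [hF d hd]) i hi j hj
  simp at this

variable [DecidableEq α] [DecidableEq β]

/-- The only edge at the leaf `i` forces `u i = v j` and constrains nothing else. If `A.erase i`
were empty, the right side would be vacuous. -/
theorem linked_insert_iff {A : Finset α} {B : Finset β} {F : Finset (α × β)} {i : α} {j : β}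
    (hj : j ∈ B) (hA : (A.erase i).Nonempty) (hF : F ⊆ A.erase i ×ˢ B) :
    Linked A B (insert (i, j) F) ↔ Linked (A.erase i) B F := by
  constructor
  · intro h u v huv k hk l hl
    have hk' := Finset.mem_erase.1 hk
    have := h (Function.update u i (v j)) v ?_ k hk'.2 l hl
    · rwa [Function.update_of_ne hk'.1] at this
    · intro d hd
      rcases Finset.mem_insert.1 hd with rfl | hd
      · simp
      · have := (Finset.mem_product.1 (hF hd)).1
        rw [Function.update_of_ne (Finset.ne_of_mem_erase this), huv d hd]
  · intro h u v huv k hk l hl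
    have hu := h u v fun d hd => huv d (Finset.mem_insert_of_mem hd)
    by_cases hki : k = i
    · obtain ⟨m, hm⟩ := hA
      rw [hki, huv (i, j) (Finset.mem_insert_self _ _), ← hu m hm j hj, hu m hm l hl]
    · exact hu k (Finset.mem_erase.2 ⟨hki, hk⟩) l hl

open Classical in
/-- The linking subsets of `A × B` with prescribed margins. -/
noncomputable def linkedSets (A : Finset α) (B : Finset β) (a : α → ℕ) (b : β → ℕ) :
    Finset (Finset (α × β)) :=
  (A ×ˢ B).powerset.filter fun F => Linked A B F ∧
    (∀ i ∈ A, #{d ∈ F | d.1 = i} = a i) ∧ ∀ j ∈ B, #{d ∈ F | d.2 = j} = b j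

theorem mem_linkedSets {A : Finset α} {B : Finset β} {a : α → ℕ} {b : β → ℕ}
    {F : Finset (α × β)} : F ∈ linkedSets A B a b ↔ F ⊆ A ×ˢ B ∧ Linked A B F ∧
      (∀ i ∈ A, #{d ∈ F | d.1 = i} = a i) ∧ ∀ j ∈ B, #{d ∈ F | d.2 = j} = b j := by
  simp [linkedSets]

theorem linkedSets_eq_empty {A : Finset α} {B : Finset β} {a : α → ℕ} {b : β → ℕ}
    (hA : A.Nonempty) {j : β} (hj : j ∈ B) (hb : b j = 0) : linkedSets A B a b = ∅ := by
  refine Finset.eq_empty_of_forall_notMem fun F hF => ?_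
  obtain ⟨-, hl, -, hF⟩ := mem_linkedSets.1 hF
  obtain ⟨i, hi⟩ := hA
  obtain ⟨d, hd, hdj⟩ := hl.exists_mem_snd hi hj
  have := hF j hj
  rw [hb, Finset.card_eq_zero] at this
  exact Finset.notMem_empty d (this ▸ Finset.mem_filter.2 ⟨hd, hdj⟩)

theorem map_prodComm_mem_linkedSets {A : Finset α} {B : Finset β} {a : α → ℕ} {b : β → ℕ}
    {F : Finset (α × β)} (hF : F ∈ linkedSets A B a b) :
    F.map (Equiv.prodComm α β).toEmbedding ∈ linkedSets B A b a := by
  obtain ⟨hs, hl, ha, hb⟩ := mem_linkedSets.1 hF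
  refine mem_linkedSets.2 ⟨?_, ?_, ?_, ?_⟩
  · intro d hd
    obtain ⟨e, he, rfl⟩ := Finset.mem_map.1 hd
    have := Finset.mem_product.1 (hs he)
    exact Finset.mem_product.2 ⟨this.2, this.1⟩
  · intro u v huv j hj i hi
    exact (hl v u (fun d hd => (huv (d.2, d.1)
      (Finset.mem_map.2 ⟨d, hd, rfl⟩)).symm) i hi j hj).symm
  · intro j hj
    rw [Finset.filter_map, Finset.card_map]
    exact hb j hj
  · intro i hi
    rw [Finset.filter_map, Finset.card_map]
    exact ha i hi

theorem card_linkedSets_swap (A : Finset α) (B : Finset β) (a : α → ℕ) (b : β → ℕ) :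
    #(linkedSets A B a b) = #(linkedSets B A b a) :=
  le_antisymm
    (Finset.card_le_card_of_injOn _ (fun _ hF => map_prodComm_mem_linkedSets hF)
      (Finset.map_injective _).injOn)
    (Finset.card_le_card_of_injOn _ (fun _ hF => map_prodComm_mem_linkedSets hF)
      (Finset.map_injective _).injOn)

/-- Removing the edge at a leaf `i`. -/
theorem insert_mem_linkedSets_iff {A : Finset α} {B : Finset β} {a : α → ℕ} {b : β → ℕ}
    {F : Finset (α × β)} {i : α} {j : β} (hi : i ∈ A) (hj : j ∈ B) (hA : (A.erase i).Nonempty)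
    (hai : a i = 1) (hbj : 1 ≤ b j) (hij : (i, j) ∉ F) :
    insert (i, j) F ∈ linkedSets A B a b ↔
      F ∈ linkedSets (A.erase i) B a (Function.update b j (b j - 1)) := by
  have hmargin : ∀ k, #{d ∈ insert (i, j) F | d.1 = k} =
      #{d ∈ F | d.1 = k} + if i = k then 1 else 0 := by
    intro k
    rw [Finset.filter_insert]
    split_ifs
    · rw [Finset.card_insert_of_notMem (by simp [hij])]
    · rfl
  have hmargin' : ∀ k, #{d ∈ insert (i, j) F | d.2 = k} =
      #{d ∈ F | d.2 = k} + if j = k then 1 else 0 := by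
    intro k
    rw [Finset.filter_insert]
    split_ifs
    · rw [Finset.card_insert_of_notMem (by simp [hij])]
    · rfl
  have hb : (∀ k ∈ B, #{d ∈ insert (i, j) F | d.2 = k} = b k) ↔
      ∀ k ∈ B, #{d ∈ F | d.2 = k} = Function.update b j (b j - 1) k := by
    refine forall₂_congr fun k _ => ?_
    rw [hmargin']
    by_cases hk : j = k
    · subst hk
      simp
      lia
    · simp [hk, Function.update_of_ne (Ne.symm hk)]
  rw [mem_linkedSets, mem_linkedSets, hb]
  constructor
  · rintro ⟨hs, hl, ha, hb⟩
    have hsub : F ⊆ A.erase i ×ˢ B := by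
      intro d hd
      have hd' := Finset.mem_product.1 (hs (Finset.mem_insert_of_mem hd))
      refine Finset.mem_product.2 ⟨Finset.mem_erase.2 ⟨fun h => ?_, hd'.1⟩, hd'.2⟩
      -- The edge `(i, j)` already uses up the degree 1 of `i`.
      have := ha i hi
      rw [hmargin, hai, if_pos rfl, Nat.add_eq_right, Finset.card_eq_zero] at this
      exact Finset.notMem_empty d (this ▸ Finset.mem_filter.2 ⟨hd, h⟩)
    refine ⟨hsub, (linked_insert_iff hj hA hsub).1 hl, fun k hk => ?_, hb⟩
    have := ha k (Finset.mem_of_mem_erase hk)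
    rwa [hmargin, if_neg (Finset.ne_of_mem_erase hk).symm] at this
  · rintro ⟨hs, hl, ha, hb⟩
    refine ⟨Finset.insert_subset (Finset.mk_mem_product hi hj)
      (hs.trans (Finset.product_subset_product_left (Finset.erase_subset _ _))),
      (linked_insert_iff hj hA hs).2 hl, fun k hk => ?_, hb⟩
    rw [hmargin]
    by_cases hk' : i = k
    · subst hk'
      rw [if_pos rfl, hai, Nat.add_eq_right, Finset.card_eq_zero, Finset.filter_eq_empty_iff]
      exact fun d hd => Finset.ne_of_mem_erase (Finset.mem_product.1 (hs hd)).1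
    · rw [if_neg hk']
      exact ha k (Finset.mem_erase.2 ⟨Ne.symm hk', hk⟩)

theorem card_linkedSets_filter_mem {A : Finset α} {B : Finset β} {a : α → ℕ} {b : β → ℕ}
    {i : α} {j : β} (hi : i ∈ A) (hj : j ∈ B) (hA : (A.erase i).Nonempty)
    (hai : a i = 1) (hbj : 1 ≤ b j) :
    #{F ∈ linkedSets A B a b | (i, j) ∈ F} =
      #(linkedSets (A.erase i) B a (Function.update b j (b j - 1))) := by
  have hnot : ∀ F ∈ linkedSets (A.erase i) B a (Function.update b j (b j - 1)),
      (i, j) ∉ F := by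
    intro F hF hij
    have := (Finset.mem_product.1 ((mem_linkedSets.1 hF).1 hij)).1
    simp at this
  refine Finset.card_nbij' (fun F => F.erase (i, j)) (fun F => insert (i, j) F) ?_ ?_ ?_ ?_
  · intro F hF
    obtain ⟨hF, hij⟩ := Finset.mem_filter.1 hF
    refine (insert_mem_linkedSets_iff hi hj hA hai hbj (Finset.notMem_erase _ _)).1 ?_
    rwa [Finset.insert_erase hij]
  · intro F hF
    exact Finset.mem_filter.2 ⟨(insert_mem_linkedSets_iff hi hj hA hai hbj (hnot F hF)).2 hF,
      Finset.mem_insert_self _ _⟩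
  · intro F hF
    exact Finset.insert_erase (Finset.mem_filter.1 hF).2
  · intro F hF
    exact Finset.erase_insert (hnot F hF)

/-- A leaf has exactly one neighbour `j`, so counting the pairs `(F, j)` with `(i, j) ∈ F` counts
each `F` once. -/
theorem card_linkedSets_eq_sum {A : Finset α} {B : Finset β} {a : α → ℕ} {b : β → ℕ}
    {i : α} (hi : i ∈ A) (hA : (A.erase i).Nonempty) (hai : a i = 1) (hb : ∀ j ∈ B, 1 ≤ b j) :
    #(linkedSets A B a b) =
      ∑ j ∈ B, #(linkedSets (A.erase i) B a (Function.update b j (b j - 1))) := by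
  have hone : ∀ F ∈ linkedSets A B a b, #{j ∈ B | (i, j) ∈ F} = 1 := by
    intro F hF
    obtain ⟨hs, -, ha, -⟩ := mem_linkedSets.1 hF
    rw [← hai, ← ha i hi]
    refine Finset.card_nbij' (fun j => (i, j)) Prod.snd ?_ ?_ ?_ ?_
    · intro j hj
      exact Finset.mem_filter.2 ⟨(Finset.mem_filter.1 hj).2, rfl⟩
    · rintro ⟨k, j⟩ hd
      obtain ⟨hd', rfl⟩ := Finset.mem_filter.1 hd
      exact Finset.mem_filter.2 ⟨(Finset.mem_product.1 (hs hd')).2, hd'⟩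
    · intro j _
      rfl
    · rintro ⟨k, j⟩ hd
      obtain ⟨-, rfl⟩ := Finset.mem_filter.1 hd
      rfl
  calc #(linkedSets A B a b)
      = ∑ F ∈ linkedSets A B a b, #{j ∈ B | (i, j) ∈ F} := by
        rw [Finset.sum_congr rfl hone, Finset.card_eq_sum_ones]
    _ = ∑ j ∈ B, #{F ∈ linkedSets A B a b | (i, j) ∈ F} :=
        Finset.sum_card_bipartiteAbove_eq_sum_card_bipartiteBelow fun F j => (i, j) ∈ F
    _ = _ := Finset.sum_congr rfl fun j hj =>
        card_linkedSets_filter_mem hi hj hA hai (hb j hj)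

/-- The formula for `A`, `B` follows from the formula for `A` with a leaf removed. -/
theorem card_linkedSets_of_leaf {A : Finset α} {B : Finset β} {a : α → ℕ} {b : β → ℕ}
    {i : α} (hi : i ∈ A) (hA : (A.erase i).Nonempty) (hai : a i = 1)
    (hb : ∀ j ∈ B, 1 ≤ b j) (hbs : ∑ j ∈ B, b j + 1 = #A + #B)
    (ih : ∀ b' : β → ℕ, (∀ j ∈ B, 1 ≤ b' j) → ∑ j ∈ B, b' j + 1 = #(A.erase i) + #B →
      #(linkedSets (A.erase i) B a b') =
        Nat.multinomial B (fun j => b' j - 1) *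
          Nat.multinomial (A.erase i) (fun k => a k - 1)) :
    #(linkedSets A B a b) =
      Nat.multinomial B (fun j => b j - 1) * Nat.multinomial A (fun k => a k - 1) := by
  have hcard := Finset.card_erase_add_one hi
  have hpos := hA.card_pos
  have hsum := sum_tsub_one_add_card hb
  -- Pascal's rule applies since the `b j - 1` sum to `#A - 1`, which is positive.
  rw [card_linkedSets_eq_sum hi hA hai hb,
    multinomial_eq_sum_update_pred B (fun j => b j - 1) (by lia), Finset.sum_mul]
  refine Finset.sum_congr rfl fun j hj => ?_
  have hbj := hb j hj
  split_ifs with h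
  -- Here `b j = 1`: removing the leaf would isolate `j`.
  · rw [linkedSets_eq_empty hA hj (by rw [Function.update_self, h]), Finset.card_empty, zero_mul]
  · have hupd := sum_update_pred B b hj (by lia)
    rw [ih _ _ (by lia), multinomial_erase_of_eq_zero A _ hi (by simp [hai])]
    · congr 2
      funext k
      by_cases hk : k = j
      · subst hk
        simp
      · simp [Function.update_of_ne hk]
    · intro k hk
      by_cases hkj : k = j
      · subst hkj
        rw [Function.update_self]
        lia
      · rw [Function.update_of_ne hkj]
        exact hb k hk

theorem card_linkedSets_singleton (i : α) (j : β) {a : α → ℕ} {b : β → ℕ}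
    (ha : a i = 1) (hb : b j = 1) : #(linkedSets {i} {j} a b) = 1 := by
  rw [Finset.card_eq_one]
  refine ⟨{(i, j)}, Finset.ext fun F => ?_⟩
  rw [mem_linkedSets, Finset.mem_singleton, Finset.singleton_product_singleton,
    Finset.subset_singleton_iff]
  constructor
  · rintro ⟨rfl | h, -, h', -⟩
    · simp [ha] at h'
    · exact h
  · rintro rfl
    refine ⟨Or.inr rfl, ?_, ?_, ?_⟩
    · intro u v huv
      simpa using huv
    · simp [ha, Finset.filter_singleton]
    · simp [hb, Finset.filter_singleton]

end Linked

/-! ### Induction on the number of vertices -/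

theorem card_linkedSets {α β : Type*} [DecidableEq α] [DecidableEq β] (A : Finset α)
    (B : Finset β) (a : α → ℕ) (b : β → ℕ) (hA : A.Nonempty) (hB : B.Nonempty)
    (ha : ∀ i ∈ A, 1 ≤ a i) (hb : ∀ j ∈ B, 1 ≤ b j)
    (has : ∑ i ∈ A, a i + 1 = #A + #B) (hbs : ∑ j ∈ B, b j + 1 = #A + #B) :
    #(linkedSets A B a b) =
      Nat.multinomial B (fun j => b j - 1) * Nat.multinomial A (fun i => a i - 1) := by
  induction hn : #A + #B using Nat.strong_induction_on generalizing A B a b with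
  | _ n ih =>
    have hA' := hA.card_pos
    have hB' := hB.card_pos
    by_cases htwo : #A = 1 ∧ #B = 1
    · obtain ⟨⟨i, rfl⟩, j, rfl⟩ := And.imp Finset.card_eq_one.1 Finset.card_eq_one.1 htwo
      simp only [Finset.sum_singleton, Finset.card_singleton] at has hbs
      rw [card_linkedSets_singleton i j (by lia) (by lia), Nat.multinomial_singleton,
        Nat.multinomial_singleton]
    -- The larger side has a leaf and, as the single edge is excluded, at least two vertices.
    rcases le_or_gt #B #A with hle | hlt
    · obtain ⟨i, hi, hai⟩ := exists_eq_one_of_sum_lt ha (by lia)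
      have hcard := Finset.card_erase_add_one hi
      have hne : (A.erase i).Nonempty := Finset.card_pos.1 (by lia)
      have hsum := Finset.add_sum_erase A a hi
      exact card_linkedSets_of_leaf hi hne hai hb hbs fun b' hb' hbs' =>
        ih _ (by lia) (A.erase i) B a b' hne hB
          (fun k hk => ha k (Finset.mem_of_mem_erase hk)) hb' (by lia) hbs' rfl
    · obtain ⟨j, hj, hbj⟩ := exists_eq_one_of_sum_lt hb (by lia)
      have hcard := Finset.card_erase_add_one hj
      have hne : (B.erase j).Nonempty := Finset.card_pos.1 (by lia)
      have hsum := Finset.add_sum_erase B b hj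
      rw [card_linkedSets_swap, mul_comm]
      refine card_linkedSets_of_leaf hj hne hbj ha (by lia) fun a' ha' has' => ?_
      rw [card_linkedSets_swap, mul_comm]
      exact ih _ (by lia) A (B.erase j) a' b hA hne ha'
          (fun k hk => hb k (Finset.mem_of_mem_erase hk)) (by lia) (by lia) rfl

/-! ### Non-singularity as connectedness -/

section ModelMatrix

variable {I J : ℕ}

open Matrix

/-- Extension by zero of the effects of the first `n - 1` levels to the last level. -/
def levelEffect {n : ℕ} (x : Fin (n - 1) → ℝ) (i : Fin n) : ℝ :=
  if h : (i : ℕ) < n - 1 then x ⟨i, h⟩ else 0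

theorem sum_indicator_level {n : ℕ} (x : Fin (n - 1) → ℝ) (i : Fin n) :
    ∑ k : Fin (n - 1), (if (i : ℕ) = (k : ℕ) then 1 else 0) * x k = levelEffect x i := by
  unfold levelEffect
  split_ifs with h
  · rw [Finset.sum_eq_single ⟨i, h⟩]
    · simp
    · intro k _ hk
      rw [if_neg fun hik => hk (Fin.ext hik.symm), zero_mul]
    · simp
  · refine Finset.sum_eq_zero fun k _ => ?_
    rw [if_neg (by have := k.2; lia), zero_mul]

theorem modelMatrix_mulVec (w : Param I J → ℝ) (d : Fin I × Fin J) :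
    (modelMatrix I J *ᵥ w) d = w (.inl ()) +
      (levelEffect (fun i => w (.inr (.inl i))) d.1 +
        levelEffect (fun j => w (.inr (.inr j))) d.2) := by
  rw [← sum_indicator_level, ← sum_indicator_level]
  simp [Matrix.mulVec, dotProduct, Fintype.sum_sum_type, modelMatrix]

theorem levelEffect_sub_last {n : ℕ} (hn : n - 1 < n) (u : Fin n → ℝ) (i : Fin n) :
    levelEffect (fun k : Fin (n - 1) => u ⟨k, by lia⟩ - u ⟨n - 1, hn⟩) i =
      u i - u ⟨n - 1, hn⟩ := by
  unfold levelEffect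
  split_ifs with h
  · rfl
  · have : i = ⟨n - 1, hn⟩ := Fin.ext (by simp; lia)
    rw [this, sub_self]

theorem levelEffect_last {n : ℕ} (hn : n - 1 < n) (x : Fin (n - 1) → ℝ) :
    levelEffect x ⟨n - 1, hn⟩ = 0 := by
  simp [levelEffect]

theorem levelEffect_castLE {n : ℕ} (x : Fin (n - 1) → ℝ) (k : Fin (n - 1)) :
    levelEffect x ⟨k, by lia⟩ = x k := by
  simp [levelEffect]

/-- Fitted values have the form `u i - v j`, with the mean absorbed into `u` and the sign of the
second effect reversed; they vanish on `F` exactly when the potentials agree along `F`. -/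
theorem linked_iff_mulVec (hI : 0 < I) (hJ : 0 < J) (F : Fraction I J) :
    Linked Finset.univ Finset.univ F ↔
      ∀ w : Param I J → ℝ, (∀ d ∈ F, (modelMatrix I J *ᵥ w) d = 0) → w = 0 := by
  have hI' : I - 1 < I := by lia
  have hJ' : J - 1 < J := by lia
  constructor
  · intro h w hw
    have key := h (fun i => w (.inl ()) + levelEffect (fun i => w (.inr (.inl i))) i)
      (fun j => -levelEffect (fun j => w (.inr (.inr j))) j) (fun d hd => by
        have := hw d hd
        rw [modelMatrix_mulVec] at this
        linarith)
    have hmean : w (.inl ()) = 0 := by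
      simpa [levelEffect_last] using
        key ⟨I - 1, hI'⟩ (Finset.mem_univ _) ⟨J - 1, hJ'⟩ (Finset.mem_univ _)
    funext p
    rcases p with _ | k | k
    · exact hmean
    · simpa [levelEffect_last, levelEffect_castLE, hmean] using
        key ⟨k, by lia⟩ (Finset.mem_univ _) ⟨J - 1, hJ'⟩ (Finset.mem_univ _)
    · simpa [levelEffect_last, levelEffect_castLE, hmean] using
        key ⟨I - 1, hI'⟩ (Finset.mem_univ _) ⟨k, by lia⟩ (Finset.mem_univ _)
  · intro h u v huv i _ j _
    let v' : Fin J → ℝ := fun j => -v j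
    -- The last levels serve as baseline, since their effects are 0 in the model.
    let w : Param I J → ℝ := Sum.elim (fun _ => u ⟨I - 1, hI'⟩ + v' ⟨J - 1, hJ'⟩)
      (Sum.elim (fun k => u ⟨k, by lia⟩ - u ⟨I - 1, hI'⟩)
        (fun k => v' ⟨k, by lia⟩ - v' ⟨J - 1, hJ'⟩))
    have hw : ∀ d, (modelMatrix I J *ᵥ w) d = u d.1 - v d.2 := by
      intro d
      rw [modelMatrix_mulVec]
      simp only [w, Sum.elim_inl, Sum.elim_inr]
      rw [levelEffect_sub_last hI' u, levelEffect_sub_last hJ' v']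
      simp only [v']
      ring
    have hzero := h w fun d hd => by rw [hw, huv d hd, sub_self]
    have := hw (i, j)
    rw [hzero, Matrix.mulVec_zero] at this
    exact (sub_eq_zero.1 this.symm)

theorem det_fractionMatrix_ne_zero_iff (F : Fraction I J) (e : Param I J ≃ {d // d ∈ F}) :
    ((fractionMatrix F).submatrix e id).det ≠ 0 ↔
      ∀ w : Param I J → ℝ, (∀ d ∈ F, (modelMatrix I J *ᵥ w) d = 0) → w = 0 := by
  have hmul : ∀ w : Param I J → ℝ, ((fractionMatrix F).submatrix e id) *ᵥ w = 0 ↔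
      ∀ d ∈ F, (modelMatrix I J *ᵥ w) d = 0 := by
    intro w
    rw [funext_iff, e.forall_congr_left, Subtype.forall]
    refine forall₂_congr fun d hd => ?_
    change (modelMatrix I J *ᵥ w) (e (e.symm ⟨d, hd⟩)) = 0 ↔ _
    rw [e.apply_symm_apply]
  rw [ne_eq, ← Matrix.exists_mulVec_eq_zero_iff, not_exists]
  refine forall_congr' fun w => ?_
  rw [hmul]
  tauto

theorem isSaturated_iff_linked (hI : 0 < I) (hJ : 0 < J) (F : Fraction I J) :
    IsSaturated F ↔ #F = I + J - 1 ∧ Linked Finset.univ Finset.univ F := by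
  refine and_congr_right fun hcard => ?_
  rw [linked_iff_mulVec hI hJ]
  simp only [det_fractionMatrix_ne_zero_iff]
  -- The kernel condition does not involve `e`, so only the existence of some ordering remains: a
  -- count of parameters.
  refine exists_const_iff.trans (and_iff_right ?_)
  refine ⟨Fintype.equivOfCardEq ?_⟩
  simp only [Fintype.card_sum, Fintype.card_unit, Fintype.card_fin, Fintype.card_coe]
  lia

theorem sum_marginA (F : Fraction I J) : ∑ i, marginA F i = #F := by
  simp only [marginA]
  rw [Finset.sum_comm]
  simp

end ModelMatrix

end TwoFactor

theorem mainTheorem3 (I J : ℕ) (hI : 2 ≤ I) (hJ : 2 ≤ J)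
    (mA : Fin I → ℕ) (mB : Fin J → ℕ)
    (hA : ∀ i, 1 ≤ mA i) (hB : ∀ j, 1 ≤ mB j)
    (hAsum : ∑ i, mA i = I + J - 1) (hBsum : ∑ j, mB j = I + J - 1) :
    Set.ncard {F : TwoFactor.Fraction I J |
        TwoFactor.IsSaturated F ∧ TwoFactor.marginA F = mA ∧ TwoFactor.marginB F = mB} =
      Nat.multinomial Finset.univ (fun j => mB j - 1) *
        Nat.multinomial Finset.univ (fun i => mA i - 1) := by
  have hset : {F : TwoFactor.Fraction I J |
      TwoFactor.IsSaturated F ∧ TwoFactor.marginA F = mA ∧ TwoFactor.marginB F = mB} =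
      (TwoFactor.linkedSets Finset.univ Finset.univ mA mB : Set (TwoFactor.Fraction I J)) := by
    ext F
    -- The margins already fix the number of points.
    have hcard : TwoFactor.marginA F = mA → F.card = I + J - 1 := fun h => by
      rw [← TwoFactor.sum_marginA, h, hAsum]
    have hmA : TwoFactor.marginA F = mA ↔ ∀ i, #{d ∈ F | d.1 = i} = mA i := by
      simp only [funext_iff, TwoFactor.marginA, Finset.card_filter]
    have hmB : TwoFactor.marginB F = mB ↔ ∀ j, #{d ∈ F | d.2 = j} = mB j := by
      simp only [funext_iff, TwoFactor.marginB, Finset.card_filter]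
    rw [Set.mem_ofPred_eq, TwoFactor.isSaturated_iff_linked (by lia) (by lia), Finset.mem_coe,
      TwoFactor.mem_linkedSets]
    simp only [Finset.mem_univ, true_imp_iff, ← hmA, ← hmB, Finset.univ_product_univ,
      Finset.subset_univ, true_and]
    tauto
  have : Nonempty (Fin I) := ⟨⟨0, by lia⟩⟩
  have : Nonempty (Fin J) := ⟨⟨0, by lia⟩⟩
  rw [hset, Set.ncard_coe_finset]
  refine TwoFactor.card_linkedSets _ _ _ _ Finset.univ_nonempty Finset.univ_nonempty
    (fun i _ => hA i) (fun j _ => hB j) ?_ ?_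
  · rw [hAsum, Finset.card_fin, Finset.card_fin]
    lia
  · rw [hBsum, Finset.card_fin, Finset.card_fin]
    lia
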